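/- For integers $k\ge 1$ and $n>k$, the Kneser graph $K(k,n)$ has as vertices the $k$-element subsets of $\{1,\dots,n\}$, two of them being adjacent if and only if they are disjoint. For a finite connected graph $G$, the metric dimension $\beta(G)$ is the least size of a set $S$ of vertices such that any two distinct vertices of $G$ have different distances to some element of $S$. In the localization game with $m$ cops on $G$, an invisible robber first chooses a vertex. In each round the cops choose $m$ vertices $u_1,\dots,u_m$ (depending only on the information from earlier rounds) and learn the distances in $G$ from $u_1,\dots,u_m$ to the robber's vertex; if the information obtained so far determines the vertex that the robber occupies, he is captured; otherwise he stays or moves to an adjacent vertex and the next round begins. The localization number $\zeta(G)$ is the least $m$ for which $m$ cops have a strategy that captures the robber after finitely many rounds, however he plays. 1. For every even integer $k\ge 4$ there is a constant $C=C(k)$ such that for all $n\ge 3k$, $$\left|\zeta(K(k,n))-\left(\frac n2+\frac nk\right)\right|\le C\quad\text{and}\quad \left|\beta(K(k,n))-\left(\frac n2+\frac nk\right)\right|\le C.$$ 2. For every odd integer $k\ge 3$ there is a constant $C=C(k)$ such that for all $n\ge 3k$, $$\frac n2+\frac nk-\frac k2-1\le \zeta(K(k,n))\le \frac n2+\frac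 nk+\frac n{2k}+C$$ and $$\frac n2+\frac nk\le \beta(K(k,n))\le \frac n2+\frac nk+\frac n{2k}+C.$$ -/

import Mathlib

/-- The Kneser graph `K(k,n)`: the vertices are the `k`-element subsets of an `n`-element set, and
two distinct vertices are adjacent if and only if they are disjoint. (For `k ≥ 1` disjoint vertices
are automatically distinct.) -/
def kneserGraph (k n : ℕ) : SimpleGraph {s : Finset (Fin n) // s.card = k} where
  Adj s t := s ≠ t ∧ Disjoint s.1 t.1
  symm := ⟨fun _ _ h => ⟨h.1.symm, h.2.symm⟩⟩
  loopless := ⟨fun _ h => h.1 rfl⟩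

namespace SimpleGraph

variable {V : Type*}

/-- A set `S` of vertices is resolving if every vertex is determined by its distances to `S`. -/
def IsResolvingSet (G : SimpleGraph V) (S : Finset V) : Prop :=
  ∀ u v : V, (∀ s ∈ S, G.dist s u = G.dist s v) → u = v

/-- The metric dimension of a (finite connected) graph. -/
noncomputable def metricDimension (G : SimpleGraph V) : ℕ :=
  sInf {m : ℕ | ∃ S : Finset V, S.card = m ∧ G.IsResolvingSet S}

/-- A play of the robber in the localization game: `r t` is his position when the cops make their
probes in round `t` (rounds are numbered from `0`). Between two rounds he moves to a neighbor or
stays. -/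
def IsRobberPlay (G : SimpleGraph V) (r : ℕ → V) : Prop :=
  ∀ t, r (t + 1) = r t ∨ G.Adj (r t) (r (t + 1))

/-- A strategy of `m` cops, who do not see the robber: it assigns to the list of the distance
vectors obtained in the earlier rounds the positions of the cops in the current round. -/
abbrev CopStrategy (V : Type*) (m : ℕ) : Type _ :=
  List (Fin m → ℕ) → (Fin m → V)

/-- The list of the distance vectors that the cops obtain in the rounds `0, …, t - 1`, when they
follow the strategy `σ` against the robber play `r`. -/
noncomputable def probeHistory (G : SimpleGraph V) {m : ℕ} (σ : CopStrategy V m) (r : ℕ → V) :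
    ℕ → List (Fin m → ℕ)
  | 0 => []
  | t + 1 => probeHistory G σ r t ++ [fun i => G.dist (σ (probeHistory G σ r t) i) (r t)]

/-- The robber play `r` is captured in round `t` by `σ`: the distance vectors obtained up to and
including round `t` determine the vertex that the robber occupies in that round, that is, every
robber play which yields the same distance vectors is at the same vertex in round `t`. -/
def CapturedAt (G : SimpleGraph V) {m : ℕ} (σ : CopStrategy V m) (r : ℕ → V) (t : ℕ) : Prop :=
  ∀ r' : ℕ → V, G.IsRobberPlay r' →
    G.probeHistory σ r' (t + 1) = G.probeHistory σ r (t + 1) → r' t = r t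

/-- `m` cops win the localization game: they have a strategy that captures every play of the robber
after finitely many rounds. -/
def CopsWin (G : SimpleGraph V) (m : ℕ) : Prop :=
  ∃ σ : CopStrategy V m, ∀ r : ℕ → V, G.IsRobberPlay r → ∃ t, G.CapturedAt σ r t

/-- The localization number of a (finite connected) graph. -/
noncomputable def localizationNumber (G : SimpleGraph V) : ℕ :=
  sInf {m : ℕ | G.CopsWin m}

end SimpleGraph

/-! For `n ≥ 3k` the Kneser graph has diameter at most two, so a probe at `s` only tells whether the
robber's set equals `s`, misses `s`, or meets it. Both numbers thus become questions about
hypergraphs whose edges are the probed `k`-sets.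

Upper bounds. Let the probes form a `d`-regular linear hypergraph without triangles and quadrangles,
with `2d ≥ k + 2`. If two `k`-sets meet the same edges, a point lying in only one of them forces `d`
points into the other, and these demands exceed the room available (`IsGirthFive.eq_of_meets_same`).
A fixed hypergraph of this kind is copied to cover all but boundedly many points, and the leftover
points are handled by boundedly many probes. This costs `dn/k + O(1)` probes and bounds `β`, hence
also `ζ ≤ β`.

Lower bounds. If the cops win, some single set of probes resolves a closed neighborhood
(`CopsWin.exists_resolving_neighborhood`), hence all `k`-subsets of a set `W` of `n - k` points; for
`β` one takes all `n` points. Up to points that are the whole trace of a probe on `W`, any two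
points must then be separated by at least `k` probes (`DistinguishesSubsets.le_card_separators`).
Hence their degrees add up to at least `k`, and to at least `k + 2` if they share a probe. Giving
each point the weight 1/degree, a probe carries total weight at most `2k/(k+2)`, apart from an
exceptional point of degree below two. So about `(k+2)/(2k) = 1/2 + 1/k` probes per point are
needed. -/

namespace SimpleGraph

/-! ### Resolving sets and the localization game -/

variable {V : Type*}

theorem IsResolvingSet.copsWin {G : SimpleGraph V} {S : Finset V} (hS : G.IsResolvingSet S) :
    G.CopsWin S.card := by
  refine ⟨fun _ i => (S.equivFin.symm i : V), fun r _ => ⟨0, fun r' _ h => ?_⟩⟩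
  refine hS _ _ fun s hs => ?_
  simp only [probeHistory, List.nil_append, List.cons.injEq, and_true] at h
  simpa using congrFun h (S.equivFin ⟨s, hs⟩)

theorem isResolvingSet_univ [Fintype V] (G : SimpleGraph V) (hG : G.Connected) :
    G.IsResolvingSet Finset.univ := fun u v h => by
  have := h u (Finset.mem_univ u)
  rw [dist_self] at this
  exact (hG.dist_eq_zero_iff).1 this.symm

theorem exists_isResolvingSet_card_eq_metricDimension {G : SimpleGraph V} {S : Finset V}
    (hS : G.IsResolvingSet S) :
    ∃ T : Finset V, T.card = G.metricDimension ∧ G.IsResolvingSet T :=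
  Nat.sInf_mem (s := {m : ℕ | ∃ S : Finset V, S.card = m ∧ G.IsResolvingSet S}) ⟨_, S, rfl, hS⟩

theorem IsResolvingSet.metricDimension_le {G : SimpleGraph V} {S : Finset V}
    (hS : G.IsResolvingSet S) : G.metricDimension ≤ S.card :=
  Nat.sInf_le ⟨S, rfl, hS⟩

theorem IsResolvingSet.localizationNumber_le_metricDimension {G : SimpleGraph V} {S : Finset V}
    (hS : G.IsResolvingSet S) : G.localizationNumber ≤ G.metricDimension := by
  obtain ⟨T, hT, hT'⟩ := exists_isResolvingSet_card_eq_metricDimension hS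
  exact hT ▸ Nat.sInf_le hT'.copsWin

theorem IsResolvingSet.copsWin_localizationNumber {G : SimpleGraph V} {S : Finset V}
    (hS : G.IsResolvingSet S) : G.CopsWin G.localizationNumber :=
  Nat.sInf_mem (s := {m : ℕ | G.CopsWin m}) ⟨_, hS.copsWin⟩

/-- The robber's last position and the history of probes, when he answers the probes `s` by moving
from `w` to `f w s`. -/
noncomputable def evasionState (G : SimpleGraph V) {m : ℕ} (σ : CopStrategy V m)
    (f : V → (Fin m → V) → V) (w : V) : ℕ → V × List (Fin m → ℕ)
  | 0 => (w, [])
  | t + 1 =>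
    let p := evasionState G σ f w t
    (f p.1 (σ p.2), p.2 ++ [fun i => G.dist (σ p.2 i) (f p.1 (σ p.2))])

theorem probeHistory_congr (G : SimpleGraph V) {m : ℕ} (σ : CopStrategy V m) {r r' : ℕ → V} {t : ℕ}
    (h : ∀ i < t, r i = r' i) : G.probeHistory σ r t = G.probeHistory σ r' t := by
  induction t with
  | zero => rfl
  | succ t ih =>
    rw [probeHistory, probeHistory, ih fun i hi => h i (by omega), h t (by omega)]

/-- If the cops win, then in some closed neighborhood some set of probes distinguishes all
vertices. -/
theorem CopsWin.exists_resolving_neighborhood [Nonempty V] {G : SimpleGraph V} {m : ℕ}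
    (h : G.CopsWin m) :
    ∃ (w : V) (s : Fin m → V), ∀ u v, (u = w ∨ G.Adj w u) → (v = w ∨ G.Adj w v) →
      (∀ i, G.dist (s i) u = G.dist (s i) v) → u = v := by
  by_contra! hcon
  choose f g hf hg hfg hne using hcon
  obtain ⟨σ, hσ⟩ := h
  obtain ⟨w⟩ := ‹Nonempty V›
  -- The strategy is deterministic, so the robber can foresee each probe and answer it by a position
  -- `f` that has an indistinguishable twin `g` in the same closed neighborhood.
  set st := evasionState G σ f w with hst
  let r : ℕ → V := fun t => (st (t + 1)).1
  have hr : ∀ t, r t = f (st t).1 (σ (st t).2) := fun t => rfl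
  have hhist : ∀ t, G.probeHistory σ r t = (st t).2 := by
    intro t
    induction t with
    | zero => rfl
    | succ t ih => rw [probeHistory, ih]; rfl
  have hplay : G.IsRobberPlay r := fun t => hf (r t) (σ (st (t + 1)).2)
  obtain ⟨t, ht⟩ := hσ r hplay
  let v := g (st t).1 (σ (st t).2)
  -- A decoy: it copies the robber before round `t`, then steps to the twin and stays there,
  -- producing the same probes through round `t`.
  let r' : ℕ → V := fun i => if i < t then r i else v
  have hr'lt : ∀ i < t, r' i = r i := fun i hi => if_pos hi
  have hr't : ∀ i, t ≤ i → r' i = v := fun i hi => if_neg (by omega)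
  have hplay' : G.IsRobberPlay r' := by
    intro i
    rcases lt_trichotomy (i + 1) t with hi | hi | hi
    · rw [hr'lt _ hi, hr'lt i (by omega)]
      exact hplay i
    · rw [hr't (i + 1) hi.ge, hr'lt i (by omega)]
      subst hi
      exact hg (r i) _
    · rw [hr't (i + 1) (by omega), hr't i (by omega)]
      exact Or.inl rfl
  have hprobe : G.probeHistory σ r' (t + 1) = G.probeHistory σ r (t + 1) := by
    rw [probeHistory, probeHistory, probeHistory_congr G σ hr'lt, hhist, hr't t le_rfl, hr t]
    congr 2
    funext i
    exact (hfg _ _ i).symm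
  have := ht r' hplay' hprobe
  rw [hr't t le_rfl, hr t] at this
  exact hne _ _ this.symm

end SimpleGraph

/-! ### Distances in Kneser graphs of diameter at most two -/

section Kneser

variable {k n : ℕ}

theorem kneserGraph_adj_iff (hk : 1 ≤ k) (s t : {s : Finset (Fin n) // s.card = k}) :
    (kneserGraph k n).Adj s t ↔ Disjoint s.1 t.1 := by
  refine ⟨fun h => h.2, fun h => ⟨?_, h⟩⟩
  rintro rfl
  rw [disjoint_self, Finset.bot_eq_empty, ← Finset.card_eq_zero, s.2] at h
  omega

theorem kneserGraph_exists_common_neighbor (hk : 1 ≤ k) (hn : 3 * k ≤ n)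
    (s t : {s : Finset (Fin n) // s.card = k}) :
    ∃ w, (kneserGraph k n).Adj s w ∧ (kneserGraph k n).Adj w t := by
  have h : k ≤ (s.1 ∪ t.1)ᶜ.card := by
    have := Finset.card_union_le s.1 t.1
    rw [Finset.card_compl, Fintype.card_fin]
    have := s.2
    have := t.2
    omega
  obtain ⟨w, hw, hwk⟩ := Finset.exists_subset_card_eq h
  refine ⟨⟨w, hwk⟩, ?_⟩
  rw [kneserGraph_adj_iff hk, kneserGraph_adj_iff hk]
  constructor
  · refine Finset.disjoint_left.2 fun x hx hxw => ?_
    have := Finset.mem_compl.1 (hw hxw)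
    exact this (Finset.mem_union_left _ hx)
  · refine Finset.disjoint_left.2 fun x hxw hx => ?_
    have := Finset.mem_compl.1 (hw hxw)
    exact this (Finset.mem_union_right _ hx)

theorem kneserGraph_nonempty (hn : k ≤ n) : Nonempty {s : Finset (Fin n) // s.card = k} := by
  obtain ⟨s, -, hs⟩ := Finset.exists_subset_card_eq (s := (Finset.univ : Finset (Fin n))) (n := k)
    (by simpa using hn)
  exact ⟨⟨s, hs⟩⟩

theorem kneserGraph_connected (hk : 1 ≤ k) (hn : 3 * k ≤ n) : (kneserGraph k n).Connected := by
  have := kneserGraph_nonempty (k := k) (n := n) (by omega)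
  refine SimpleGraph.Connected.mk fun s t => ?_
  obtain ⟨w, hsw, hwt⟩ := kneserGraph_exists_common_neighbor hk hn s t
  exact hsw.reachable.trans hwt.reachable

theorem kneserGraph_dist_eq_one_iff (hk : 1 ≤ k) (s t : {s : Finset (Fin n) // s.card = k}) :
    (kneserGraph k n).dist s t = 1 ↔ Disjoint s.1 t.1 := by
  rw [SimpleGraph.dist_eq_one_iff_adj, kneserGraph_adj_iff hk]

theorem kneserGraph_dist_eq_two (hk : 1 ≤ k) (hn : 3 * k ≤ n)
    {s t : {s : Finset (Fin n) // s.card = k}} (hst : s ≠ t) (hd : ¬ Disjoint s.1 t.1) :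
    (kneserGraph k n).dist s t = 2 := by
  obtain ⟨w, hsw, hwt⟩ := kneserGraph_exists_common_neighbor hk hn s t
  have h2 : (kneserGraph k n).dist s t ≤ 2 :=
    SimpleGraph.dist_le (SimpleGraph.Walk.cons hsw (SimpleGraph.Walk.cons hwt .nil))
  have h0 : (kneserGraph k n).dist s t ≠ 0 := fun h =>
    hst ((kneserGraph_connected hk hn).dist_eq_zero_iff.1 h)
  have h1 : (kneserGraph k n).dist s t ≠ 1 := fun h =>
    hd ((kneserGraph_dist_eq_one_iff hk s t).1 h)
  omega

theorem kneserGraph_dist_eq_dist (hk : 1 ≤ k) (hn : 3 * k ≤ n)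
    {s u v : {s : Finset (Fin n) // s.card = k}} (hu : s ≠ u) (hv : s ≠ v)
    (h : Disjoint s.1 u.1 ↔ Disjoint s.1 v.1) :
    (kneserGraph k n).dist s u = (kneserGraph k n).dist s v := by
  by_cases hd : Disjoint s.1 u.1
  · rw [(kneserGraph_dist_eq_one_iff hk s u).2 hd, (kneserGraph_dist_eq_one_iff hk s v).2 (h.1 hd)]
  · rw [kneserGraph_dist_eq_two hk hn hu hd, kneserGraph_dist_eq_two hk hn hv (mt h.2 hd)]

end Kneser

/-! ### Hypergraphs without short cycles -/

section Incidence

variable {X I : Type*} {d : ℕ}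

/-- A hypergraph whose edges come in `d` classes, each vertex `x` lying in exactly one edge
`inc x j` of each class `j`, without cycles of length two, three or four. -/
structure IsGirthFive (inc : X → Fin d → I) : Prop where
  linear : ∀ {x y : X} {i j : Fin d}, x ≠ y → inc x i = inc y i → inc x j = inc y j → i = j
  no_triangle : ∀ {x y z : X} {a b c : Fin d}, x ≠ y → y ≠ z → z ≠ x → a ≠ c → b ≠ c →
    inc x a = inc y a → inc y b = inc z b → inc z c = inc x c → False
  no_quadrangle : ∀ {x y z w : X} {a b c e : Fin d}, x ≠ y → y ≠ z → z ≠ w → w ≠ x → x ≠ z →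
    a ≠ e → b ≠ c → inc x a = inc y a → inc y b = inc z b → inc z c = inc w c →
    inc w e = inc x e → False

namespace IsGirthFive

variable {inc : X → Fin d → I}

theorem exists_transversal (h : IsGirthFive inc) {v : Finset X} {x : X} (hx : x ∉ v)
    (hv : ∀ j, ∃ y ∈ v, inc x j = inc y j) :
    ∃ N : Fin d → X, Function.Injective N ∧ (∀ j, N j ∈ v) ∧ (∀ j, inc x j = inc (N j) j) ∧
      ∀ j, x ≠ N j := by
  choose N hN hinc using hv
  have hne : ∀ j, x ≠ N j := fun j hj => hx (hj ▸ hN j)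
  refine ⟨N, fun i j hij => ?_, hN, hinc, hne⟩
  exact h.linear (hne i) (hinc i) (by rw [hij]; exact hinc j)

variable [DecidableEq X]

/-- Two common neighbors of `x` and `y` would close a quadrangle, so the two transversals share at
most one point. -/
theorem two_mul_le_card_union (h : IsGirthFive inc) {x y : X} (hxy : x ≠ y) {N M : Fin d → X}
    (hN : Function.Injective N) (hM : Function.Injective M)
    (hxN : ∀ j, inc x j = inc (N j) j) (hyM : ∀ j, inc y j = inc (M j) j)
    (hx : ∀ j, x ≠ N j) (hy : ∀ j, y ≠ M j) :
    2 * d ≤ (Finset.univ.image N ∪ Finset.univ.image M).card + 1 := by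
  have hcap : (Finset.univ.image N ∩ Finset.univ.image M).card ≤ 1 := by
    refine Finset.card_le_one.2 fun s hs t ht => ?_
    simp only [Finset.mem_inter, Finset.mem_image, Finset.mem_univ, true_and] at hs ht
    obtain ⟨⟨a, rfl⟩, ⟨b, hb⟩⟩ := hs
    obtain ⟨⟨e, rfl⟩, ⟨c, hc⟩⟩ := ht
    by_contra hne
    refine h.no_quadrangle (x := x) (y := N a) (z := y) (w := N e) (a := a) (b := b) (c := c)
      (e := e) (hx a) (hb ▸ (hy b).symm) (hc ▸ hy c) (hx e).symm hxy ?_ ?_ (hxN a) ?_ ?_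
      (hxN e).symm
    · rintro rfl; exact hne rfl
    · rintro rfl; exact hne (hb.symm.trans hc)
    · rw [← hb]; exact (hyM b).symm
    · rw [← hc]; exact hyM c
  have := Finset.card_union_add_card_inter (Finset.univ.image N) (Finset.univ.image M)
  rw [Finset.card_image_of_injective _ hN, Finset.card_image_of_injective _ hM, Finset.card_univ,
    Fintype.card_fin] at this
  omega

theorem card_sdiff_le_one (h : IsGirthFive inc) {u v : Finset X} (hd : v.card + 2 ≤ 2 * d)
    (huv : ∀ x ∈ u, ∀ j, ∃ y ∈ v, inc x j = inc y j) : (u \ v).card ≤ 1 := by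
  refine Finset.card_le_one.2 fun x hx y hy => ?_
  by_contra hxy
  rw [Finset.mem_sdiff] at hx hy
  obtain ⟨N, hN, hNv, hxN, hx'⟩ := h.exists_transversal hx.2 (huv x hx.1)
  obtain ⟨M, hM, hMv, hyM, hy'⟩ := h.exists_transversal hy.2 (huv y hy.1)
  have h1 := h.two_mul_le_card_union hxy hN hM hxN hyM hx' hy'
  have h2 : (Finset.univ.image N ∪ Finset.univ.image M) ⊆ v := by
    intro z hz
    simp only [Finset.mem_union, Finset.mem_image, Finset.mem_univ, true_and] at hz
    obtain ⟨j, rfl⟩ | ⟨j, rfl⟩ := hz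
    exacts [hNv j, hMv j]
  have := Finset.card_le_card h2
  omega

/-- Two small sets of the same size that meet the same edges are equal. -/
theorem eq_of_meets_same (h : IsGirthFive inc) {u v : Finset X} (hcard : u.card = v.card)
    (hd : u.card + 2 ≤ 2 * d) (huv : ∀ x ∈ u, ∀ j, ∃ y ∈ v, inc x j = inc y j)
    (hvu : ∀ x ∈ v, ∀ j, ∃ y ∈ u, inc x j = inc y j) : u = v := by
  by_contra hne
  have hX := h.card_sdiff_le_one (hcard ▸ hd) huv
  have hY := h.card_sdiff_le_one hd hvu
  obtain ⟨x, hx⟩ : (u \ v).Nonempty := by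
    rw [Finset.sdiff_nonempty]
    exact fun hs => hne (Finset.eq_of_subset_of_card_le hs hcard.ge)
  obtain ⟨y, hy⟩ : (v \ u).Nonempty := by
    rw [Finset.sdiff_nonempty]
    exact fun hs => hne (Finset.eq_of_subset_of_card_le hs hcard.le).symm
  have hX' : ∀ z ∈ u, z ≠ x → z ∈ v := fun z hz hzx => by
    by_contra hzv
    exact hzx (Finset.card_le_one.1 hX z (Finset.mem_sdiff.2 ⟨hz, hzv⟩) x hx)
  have hY' : ∀ z ∈ v, z ≠ y → z ∈ u := fun z hz hzy => by
    by_contra hzu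
    exact hzy (Finset.card_le_one.1 hY z (Finset.mem_sdiff.2 ⟨hz, hzu⟩) y hy)
  rw [Finset.mem_sdiff] at hx hy
  have hxy : x ≠ y := fun e => hx.2 (e ▸ hy.1)
  obtain ⟨N, hN, hNv, hxN, hx'⟩ := h.exists_transversal hx.2 (huv x hx.1)
  obtain ⟨M, hM, hMu, hyM, hy'⟩ := h.exists_transversal hy.2 (hvu y hy.1)
  -- Now `u = T ∪ {x}` and `v = T ∪ {y}` with `T = v.erase y`, so `T` has at most `2d - 3` points.
  -- Neighbors of `x` and `y` fill `T` with `2(d - 1)` points if `x`, `y` share an edge (no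
  -- triangle), and with `2d - 1` points otherwise.
  have hT : (v.erase y).card + 1 = u.card := by
    rw [hcard]; exact Finset.card_erase_add_one hy.1
  have hMT : ∀ j, M j ≠ x → M j ∈ v.erase y := fun j hj =>
    Finset.mem_erase.2 ⟨(hy' j).symm, hX' _ (hMu j) hj⟩
  by_cases hc : ∃ j, inc x j = inc y j
  · obtain ⟨c, hc⟩ := hc
    have hNy : ∀ j, j ≠ c → N j ≠ y := fun j hj e =>
      hj (h.linear hxy (e ▸ hxN j) hc)
    have hMx : ∀ j, j ≠ c → M j ≠ x := fun j hj e =>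
      hj (h.linear hxy.symm (e ▸ hyM j) hc.symm)
    have hdisj : Disjoint ((Finset.univ.erase c).image N) ((Finset.univ.erase c).image M) := by
      refine Finset.disjoint_left.2 fun t ht ht' => ?_
      simp only [Finset.mem_image, Finset.mem_erase, Finset.mem_univ, and_true] at ht ht'
      obtain ⟨a, ha, rfl⟩ := ht
      obtain ⟨b, hb, hab⟩ := ht'
      exact h.no_triangle (hx' a) (hNy a ha) hxy.symm ha hb (hxN a)
        (by rw [← hab]; exact (hyM b).symm) hc.symm
    have hsub : (Finset.univ.erase c).image N ∪ (Finset.univ.erase c).image M ⊆ v.erase y := by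
      intro z hz
      simp only [Finset.mem_union, Finset.mem_image, Finset.mem_erase, Finset.mem_univ,
        and_true] at hz
      obtain ⟨j, hj, rfl⟩ | ⟨j, hj, rfl⟩ := hz
      exacts [Finset.mem_erase.2 ⟨hNy j hj, hNv j⟩, hMT j (hMx j hj)]
    have := Finset.card_le_card hsub
    rw [Finset.card_union_of_disjoint hdisj, Finset.card_image_of_injective _ hN,
      Finset.card_image_of_injective _ hM, Finset.card_erase_of_mem (Finset.mem_univ c),
      Finset.card_univ, Fintype.card_fin] at this
    omega
  · push Not at hc
    have h1 := h.two_mul_le_card_union hxy hN hM hxN hyM hx' hy'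
    have hsub : (Finset.univ.image N ∪ Finset.univ.image M) ⊆ v.erase y := by
      intro z hz
      simp only [Finset.mem_union, Finset.mem_image, Finset.mem_univ, true_and] at hz
      obtain ⟨j, rfl⟩ | ⟨j, rfl⟩ := hz
      · exact Finset.mem_erase.2 ⟨fun e => hc j (by rw [hxN j, e]), hNv j⟩
      · exact hMT j fun e => hc j (by rw [hyM j, e])
    have := Finset.card_le_card hsub
    omega

end IsGirthFive

/-! ### The quasi-cyclic construction -/

/-- The edge of class `j` through the vertex `(c, i, b)` of the disjoint union of copies, indexed by
`c`, of a quasi-cyclic hypergraph. -/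
def quasiCyclicInc {C : Type*} {k d : ℕ} (x : C × Fin k × (Fin k × Fin d → ZMod 3)) (j : Fin d) :
    C × (Fin k × Fin d → ZMod 3) :=
  (x.1, x.2.2 - Pi.single (x.2.1, j) 1)

section QuasiCyclic

variable {C : Type*} {k d : ℕ}

theorem quasiCyclicInc_eq_iff {x y : C × Fin k × (Fin k × Fin d → ZMod 3)} {j : Fin d} :
    quasiCyclicInc x j = quasiCyclicInc y j ↔
      x.1 = y.1 ∧ x.2.2 - y.2.2 = Pi.single (x.2.1, j) 1 - Pi.single (y.2.1, j) 1 := by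
  simp only [quasiCyclicInc, Prod.mk.injEq]
  refine and_congr_right fun _ => ?_
  constructor <;> intro h
  · linear_combination (exp := 1) h
  · linear_combination (exp := 1) h

theorem quasiCyclicInc_index_ne {x y : C × Fin k × (Fin k × Fin d → ZMod 3)} {j : Fin d}
    (hxy : x ≠ y) (h : quasiCyclicInc x j = quasiCyclicInc y j) : x.2.1 ≠ y.2.1 := by
  rw [quasiCyclicInc_eq_iff] at h
  intro e
  rw [e, sub_self, sub_eq_zero] at h
  exact hxy (Prod.ext h.1 (Prod.ext e h.2))

/-- Points on a common edge of class `j` differ by a difference of two unit vectors with second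
index `j`. Around a closed walk these differences sum to zero, but in a short cycle some coordinate
cannot cancel. -/
theorem isGirthFive_quasiCyclicInc :
    IsGirthFive (quasiCyclicInc (C := C) (k := k) (d := d)) where
  linear {x y i j} hxy hi hj := by
    have hne := quasiCyclicInc_index_ne hxy hi
    rw [quasiCyclicInc_eq_iff] at hi hj
    have := congrFun (hi.2.symm.trans hj.2) (x.2.1, i)
    by_contra hij
    simp [hne, hij] at this
  no_triangle {x y z a b c} hxy hyz hzx hac hbc h1 h2 h3 := by
    have e1 := quasiCyclicInc_index_ne hxy h1
    have e3 := quasiCyclicInc_index_ne hzx h3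
    rw [quasiCyclicInc_eq_iff] at h1 h2 h3
    have := congrArg₂ (· + ·) (congrArg₂ (· + ·) h1.2 h2.2) h3.2
    have := congrFun this (x.2.1, c)
    simp [e1, e3.symm, hac.symm, hbc.symm] at this
  no_quadrangle {x y z w a b c e} hxy hyz hzw hwx hxz hae hbc h1 h2 h3 h4 := by
    have e1 := quasiCyclicInc_index_ne hxy h1
    have e4 := quasiCyclicInc_index_ne hwx h4
    have key : z.2.1 = x.2.1 ∧ b = a := by
      rw [quasiCyclicInc_eq_iff] at h1 h2 h3 h4
      have := congrArg₂ (· + ·) (congrArg₂ (· + ·) h1.2 h2.2) (congrArg₂ (· + ·) h3.2 h4.2)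
      have := congrFun this (x.2.1, a)
      by_contra hcon
      have hcon' : ¬ (x.2.1 = z.2.1 ∧ a = b) := fun h => hcon ⟨h.1.symm, h.2.symm⟩
      by_cases hzc : x.2.1 = z.2.1 ∧ a = c
      · obtain ⟨hz, rfl⟩ := hzc
        simp [e1, e4.symm, hae, hbc.symm, ← hz] at this
        -- Here two units add up to `2`, which is nonzero modulo 3; modulo 2 they would cancel.
        exact absurd this (by decide)
      · simp [e1, e4.symm, hae, hcon', hzc] at this
    obtain ⟨hz, rfl⟩ := key
    exact quasiCyclicInc_index_ne hxz (h1.trans h2) hz.symm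

end QuasiCyclic

end Incidence

/-! ### Construction of a small resolving set -/

section KneserUpper

variable {k n : ℕ}

theorem mem_iff_mem_of_disjoint_iff {Q u v : Finset (Fin n)} (hk : 1 ≤ k) (hQ : 2 * k ≤ Q.card)
    (hv : v.card = k)
    (h : ∀ s ⊆ Q, s.card = k → Disjoint s v → Disjoint s u) {x : Fin n} (hx : x ∈ Q)
    (hxu : x ∈ u) : x ∈ v := by
  by_contra hxv
  have hcard : k ≤ (Q \ v).card := by
    have := Finset.le_card_sdiff v Q
    omega
  obtain ⟨s, hxs, hs, hsk⟩ := Finset.exists_subsuperset_card_eq (s := {x}) (t := Q \ v) (n := k)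
    (by simp [hx, hxv]) (by simpa using hk) hcard
  have hsv : Disjoint s v := Finset.disjoint_of_subset_left hs Finset.sdiff_disjoint
  have := h s (hs.trans Finset.sdiff_subset) hsk hsv
  exact Finset.disjoint_left.1 this (hxs (Finset.mem_singleton_self x)) hxu

theorem exists_isResolvingSet_kneserGraph {d : ℕ} (hk : 1 ≤ k) (hd : k + 2 ≤ 2 * d) :
    ∃ C : ℕ, ∀ n, 3 * k ≤ n → ∃ S, (kneserGraph k n).IsResolvingSet S ∧
      k * S.card ≤ d * n + C := by
  classical
  set A := Fin k × Fin d → ZMod 3 with hA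
  set N := k * Fintype.card A with hN
  have hNpos : 0 < N := Nat.mul_pos hk Fintype.card_pos
  refine ⟨k * 2 ^ (N + 2 * k), fun n hn => ?_⟩
  set M := n / N with hM
  have hMN : M * N ≤ n := Nat.div_mul_le_self n N
  obtain ⟨φ⟩ : Nonempty (Fin M × Fin k × A ↪ Fin n) :=
    Function.Embedding.nonempty_of_card_le (by simpa [Fintype.card_prod] using hMN)
  set R : Finset (Fin n) := (Finset.univ.map φ)ᶜ with hR
  have hRcard : R.card ≤ N := by
    rw [hR, Finset.card_compl, Finset.card_map, Finset.card_univ, Fintype.card_fin,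
      Fintype.card_prod, Fintype.card_prod, Fintype.card_fin, Fintype.card_fin]
    have := Nat.div_add_mod n N
    have := Nat.mod_lt n hNpos
    have : M * N = N * (n / N) := mul_comm _ _
    rw [← hN]
    omega
  -- The uncovered points `R` are padded to at least `2k` points, so that the `k`-subsets of `Q`
  -- reveal the trace of the robber's set on `Q`. Since `|Q| ≤ N + 2k`, their number is bounded
  -- independently of `n`.
  obtain ⟨Q, hRQ, hQ⟩ := Finset.exists_superset_card_eq (s := R) (n := max R.card (2 * k))
    (le_max_left _ _) (by
      have := Finset.card_le_univ R
      rw [Fintype.card_fin] at this ⊢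
      omega)
  let pt : Fin M × Fin d × A → Fin k → Fin M × Fin k × A :=
    fun p i => (p.1, i, p.2.2 + Pi.single (i, p.2.1) 1)
  have hpt : ∀ p, Function.Injective (pt p) := fun p i j hij => congrArg (fun x => x.2.1) hij
  let edge : Fin M × Fin d × A → {s : Finset (Fin n) // s.card = k} := fun p =>
    ⟨Finset.univ.image fun i => φ (pt p i), by
      rw [Finset.card_image_of_injective (f := fun i => φ (pt p i)) _
        (fun i j hij => hpt p (φ.injective hij)), Finset.card_univ, Fintype.card_fin]⟩
  refine ⟨Finset.univ.image edge ∪ Finset.univ.filter (fun s => s.1 ⊆ Q), ?_, ?_⟩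
  · intro u v h
    have hdisj : ∀ s ∈ Finset.univ.image edge ∪ Finset.univ.filter (fun s => s.1 ⊆ Q),
        (Disjoint s.1 u.1 ↔ Disjoint s.1 v.1) := fun s hs => by
      rw [← kneserGraph_dist_eq_one_iff hk, ← kneserGraph_dist_eq_one_iff hk, h s hs]
    have hdisjQ : ∀ s ⊆ Q, s.card = k → (Disjoint s u.1 ↔ Disjoint s v.1) := fun s hs hsk =>
      hdisj ⟨s, hsk⟩ (Finset.mem_union_right _ (by simpa using hs))
    have hQuv : ∀ x ∈ Q, (x ∈ u.1 ↔ x ∈ v.1) := fun x hx =>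
      ⟨mem_iff_mem_of_disjoint_iff hk (by omega) v.2 (fun s hs hsk => (hdisjQ s hs hsk).2) hx,
        mem_iff_mem_of_disjoint_iff hk (by omega) u.2 (fun s hs hsk => (hdisjQ s hs hsk).1) hx⟩
    let pre : Finset (Fin n) → Finset (Fin M × Fin k × A) := fun w =>
      Finset.univ.filter fun x => φ x ∈ w
    have hpre : ∀ w, (pre w).map φ = w \ R := by
      intro w
      ext z
      simp only [pre, hR, Finset.mem_map, Finset.mem_filter, Finset.mem_univ, true_and,
        Finset.mem_sdiff, Finset.mem_compl, not_not]
      constructor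
      · rintro ⟨x, hx, rfl⟩
        exact ⟨hx, x, rfl⟩
      · rintro ⟨hz, x, rfl⟩
        exact ⟨x, hz, rfl⟩
    have hinter : u.1 ∩ R = v.1 ∩ R := by
      ext z
      simp only [Finset.mem_inter, and_congr_left_iff]
      exact fun hz => hQuv z (hRQ hz)
    have hcardpre : ∀ w, (pre w).card + (w ∩ R).card = w.card := fun w => by
      rw [← Finset.card_map φ, hpre, Finset.card_sdiff_add_card_inter]
    have hmeet : ∀ u v : Finset (Fin n), (∀ p, Disjoint (edge p).1 v → Disjoint (edge p).1 u) →
        ∀ x ∈ pre u, ∀ j, ∃ y ∈ pre v, quasiCyclicInc x j = quasiCyclicInc y j := by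
      intro u v huv x hx j
      have hxu : φ x ∈ u := (Finset.mem_filter.1 hx).2
      let p : Fin M × Fin d × A := (x.1, j, x.2.2 - Pi.single (x.2.1, j) 1)
      have hxp : φ x ∈ (edge p).1 :=
        Finset.mem_image.2 ⟨x.2.1, Finset.mem_univ _, by simp [pt, p]⟩
      have := mt (huv p) fun hd => Finset.disjoint_left.1 hd hxp hxu
      obtain ⟨z, hz, hzv⟩ := Finset.not_disjoint_iff.1 this
      obtain ⟨i, -, rfl⟩ := Finset.mem_image.1 hz
      refine ⟨pt p i, Finset.mem_filter.2 ⟨Finset.mem_univ _, hzv⟩, ?_⟩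
      simp [quasiCyclicInc, pt, p]
    have hedge : ∀ p, (Disjoint (edge p).1 u.1 ↔ Disjoint (edge p).1 v.1) := fun p =>
      hdisj _ (Finset.mem_union_left _ (Finset.mem_image_of_mem _ (Finset.mem_univ p)))
    have hu := hcardpre u.1
    have hv := hcardpre v.1
    rw [hinter, u.2] at hu
    rw [v.2] at hv
    have heq : pre u.1 = pre v.1 :=
      isGirthFive_quasiCyclicInc.eq_of_meets_same (by omega) (by omega)
        (hmeet _ _ fun p => (hedge p).2) (hmeet _ _ fun p => (hedge p).1)
    apply Subtype.ext
    rw [← Finset.sdiff_union_inter u.1 R, ← Finset.sdiff_union_inter v.1 R, ← hpre, ← hpre, heq,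
      hinter]
  · have h1 : (Finset.univ.image edge).card ≤ M * (d * Fintype.card A) := by
      refine Finset.card_image_le.trans ?_
      simp [Fintype.card_prod]
    have h2 : (Finset.univ.filter fun s : {s : Finset (Fin n) // s.card = k} => s.1 ⊆ Q).card ≤
        2 ^ (N + 2 * k) := by
      calc _ ≤ Q.powerset.card :=
            Finset.card_le_card_of_injOn (fun s => s.1) (fun s hs => by simpa using hs)
              Subtype.val_injective.injOn
        _ = 2 ^ Q.card := Finset.card_powerset Q
        _ ≤ _ := Nat.pow_le_pow_right (by norm_num) (by omega)
    have h3 := Finset.card_union_le (Finset.univ.image edge)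
      (Finset.univ.filter fun s : {s : Finset (Fin n) // s.card = k} => s.1 ⊆ Q)
    calc _ ≤ k * (M * (d * Fintype.card A) + 2 ^ (N + 2 * k)) :=
          Nat.mul_le_mul_left k (h3.trans (add_le_add h1 h2))
      _ = d * (M * N) + k * 2 ^ (N + 2 * k) := by rw [hN]; ring
      _ ≤ _ := by gcongr

end KneserUpper

/-! ### Separating pairs of points -/

section Distinguishing

variable {α ι : Type*} [DecidableEq α] [Fintype ι] {k : ℕ}

/-- The indices of the sets that contain exactly one of `x` and `y`. -/
def separators (E : ι → Finset α) (x y : α) : Finset ι :=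
  Finset.univ.filter fun i => ¬ (x ∈ E i ↔ y ∈ E i)

theorem mem_separators {E : ι → Finset α} {x y : α} {i : ι} :
    i ∈ separators E x y ↔ ¬ (x ∈ E i ↔ y ∈ E i) := by simp [separators]

/-- The probes `E` distinguish all `k`-subsets of `W` in a Kneser graph of diameter two. -/
def DistinguishesSubsets (E : ι → Finset α) (W : Finset α) (k : ℕ) : Prop :=
  ∀ u ⊆ W, ∀ v ⊆ W, u.card = k → v.card = k → u ≠ v →
    ∃ i, E i = u ∨ E i = v ∨ ¬ (Disjoint (E i) u ↔ Disjoint (E i) v)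

variable {E : ι → Finset α} {W : Finset α} {x y : α}

/-- A probe separating `x` from `y` already meets `T`, and any other probe treats `x` and `y` alike.
Hence disjointness cannot tell the two sets apart, and only equality with a probe can. -/
theorem DistinguishesSubsets.exists_eq_insert (h : DistinguishesSubsets E W k) (hx : x ∈ W)
    (hy : y ∈ W) (hxy : x ≠ y) {T : Finset α} (hTW : T ⊆ W) (hxT : x ∉ T) (hyT : y ∉ T)
    (hT : T.card + 1 = k) (hit : ∀ i ∈ separators E x y, ∃ t ∈ T, t ∈ E i) :
    ∃ i ∈ separators E x y, E i = insert x T ∨ E i = insert y T := by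
  obtain ⟨i, hi⟩ := h (insert x T) (Finset.insert_subset hx hTW) (insert y T)
    (Finset.insert_subset hy hTW) (by rw [Finset.card_insert_of_notMem hxT, hT])
    (by rw [Finset.card_insert_of_notMem hyT, hT]) (fun e => by
      have : x ∈ insert y T := e ▸ Finset.mem_insert_self x T
      rcases Finset.mem_insert.1 this with h | h
      exacts [hxy h, hxT h])
  have hdis : Disjoint (E i) (insert x T) ↔ Disjoint (E i) (insert y T) := by
    rw [Finset.disjoint_insert_right, Finset.disjoint_insert_right]
    by_cases hi' : i ∈ separators E x y
    · obtain ⟨t, ht, hti⟩ := hit i hi'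
      have : ¬ Disjoint (E i) T := Finset.not_disjoint_iff.2 ⟨t, hti, ht⟩
      tauto
    · rw [mem_separators, not_not] at hi'
      tauto
  have hi' : E i = insert x T ∨ E i = insert y T := by tauto
  refine ⟨i, mem_separators.2 ?_, hi'⟩
  rcases hi' with e | e <;> simp [e, hxT, hyT, hxy, hxy.symm]

/-- After enlarging `T` to `k - 2` points, one slot `w` remains free. Each of at least `k` choices
of `w` forces a separator equal to one of two sets, from which `w` can be recovered. -/
theorem DistinguishesSubsets.le_card_separators_of_hit (h : DistinguishesSubsets E W k)
    (hW : 2 * k ≤ W.card) (hx : x ∈ W) (hy : y ∈ W) (hxy : x ≠ y) {T : Finset α} (hTW : T ⊆ W)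
    (hxT : x ∉ T) (hyT : y ∉ T) (hT : T.card + 2 ≤ k)
    (hit : ∀ i ∈ separators E x y, ∃ t ∈ T, t ∈ E i) : k ≤ (separators E x y).card := by
  have hW' : ((W.erase x).erase y).card + 2 = W.card := by
    have h1 := Finset.card_erase_add_one (Finset.mem_erase.2 ⟨hxy.symm, hy⟩ : y ∈ W.erase x)
    have h2 := Finset.card_erase_add_one hx
    omega
  obtain ⟨U, hTU, hUW, hU⟩ := Finset.exists_subsuperset_card_eq (s := T)
    (t := (W.erase x).erase y) (n := k - 2) (fun t ht => by
      refine Finset.mem_erase.2 ⟨?_, Finset.mem_erase.2 ⟨?_, hTW ht⟩⟩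
      · rintro rfl; exact hyT ht
      · rintro rfl; exact hxT ht) (by omega) (by omega)
  have hZ : k ≤ (((W.erase x).erase y) \ U).card := by
    rw [Finset.card_sdiff_of_subset hUW]
    omega
  have hex : ∀ w ∈ ((W.erase x).erase y) \ U, ∃ i ∈ separators E x y,
      E i = insert x (insert w U) ∨ E i = insert y (insert w U) := by
    intro w hw
    obtain ⟨hw, hwU⟩ := Finset.mem_sdiff.1 hw
    obtain ⟨hwy, hw⟩ := Finset.mem_erase.1 hw
    obtain ⟨hwx, hwW⟩ := Finset.mem_erase.1 hw
    have hxU : x ∉ U := fun hxU => by simpa using hUW hxU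
    have hyU : y ∉ U := fun hyU => by simpa using hUW hyU
    refine h.exists_eq_insert hx hy hxy (Finset.insert_subset hwW fun t ht => ?_) ?_ ?_ ?_ ?_
    · exact Finset.mem_of_mem_erase (Finset.mem_of_mem_erase (hUW ht))
    · simp [hwx.symm, hxU]
    · simp [hwy.symm, hyU]
    · rw [Finset.card_insert_of_notMem hwU]; omega
    · intro i hi
      obtain ⟨t, ht, hti⟩ := hit i hi
      exact ⟨t, Finset.mem_insert_of_mem (hTU ht), hti⟩
  have : Nonempty ι := by
    obtain ⟨w, hw⟩ := Finset.card_pos.1 (by omega : 0 < (((W.erase x).erase y) \ U).card)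
    exact (hex w hw).nonempty
  choose! f hf hfE using hex
  refine hZ.trans (Finset.card_le_card_of_injOn f hf fun w hw w' hw' hww => ?_)
  have h1 : w ∈ E (f w) := by rcases hfE w hw with e | e <;> simp [e]
  rw [hww] at h1
  have hw1 : w ≠ x ∧ w ≠ y ∧ w ∉ U := by
    have := hw
    simp only [Finset.coe_sdiff, Set.mem_sdiff, Finset.mem_coe, Finset.mem_erase] at this
    tauto
  rcases hfE w' hw' with e | e <;>
  · rw [e, Finset.mem_insert, Finset.mem_insert] at h1
    tauto

/-- If `E` distinguishes the `k`-subsets of `W`, and no set of `E` meets `W` only in `x` or only in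
`y`, then at least `k` sets of `E` separate `x` from `y`. -/
theorem DistinguishesSubsets.le_card_separators (h : DistinguishesSubsets E W k) (hk : 3 ≤ k)
    (hW : 2 * k ≤ W.card) (hx : x ∈ W) (hy : y ∈ W) (hxy : x ≠ y) (hxs : ∀ i, E i ∩ W ≠ {x})
    (hys : ∀ i, E i ∩ W ≠ {y}) : k ≤ (separators E x y).card := by
  by_contra! hlt
  have hex : ∀ i ∈ separators E x y, ∃ t, t ∈ E i ∧ t ∈ W ∧ t ≠ x ∧ t ≠ y := by
    intro i hi
    rw [mem_separators] at hi
    have aux : ∀ z w, z ∈ W → z ∈ E i → w ∉ E i → E i ∩ W ≠ {z} →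
        ∃ t, t ∈ E i ∧ t ∈ W ∧ t ≠ z ∧ t ≠ w := by
      intro z w hzW hz hw hne
      by_contra! hcon
      refine hne (Finset.eq_singleton_iff_unique_mem.2 ⟨Finset.mem_inter.2 ⟨hz, hzW⟩, ?_⟩)
      intro t ht
      rw [Finset.mem_inter] at ht
      by_contra htz
      exact hw (hcon t ht.1 ht.2 htz ▸ ht.1)
    by_cases hxi : x ∈ E i
    · exact aux x y hx hxi (by tauto) (hxs i)
    · obtain ⟨t, h1, h2, h3, h4⟩ := aux y x hy (by tauto) hxi (hys i)
      exact ⟨t, h1, h2, h4, h3⟩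
  have : Nonempty α := ⟨x⟩
  choose! t htE htW htx hty using hex
  set T := (separators E x y).image t with hT
  have hTW : T ⊆ W := Finset.image_subset_iff.2 htW
  have hxT : x ∉ T := fun hmem => by
    obtain ⟨i, hi, e⟩ := Finset.mem_image.1 hmem
    exact htx i hi e
  have hyT : y ∉ T := fun hmem => by
    obtain ⟨i, hi, e⟩ := Finset.mem_image.1 hmem
    exact hty i hi e
  have hit : ∀ i ∈ separators E x y, ∃ s ∈ T, s ∈ E i := fun i hi =>
    ⟨t i, Finset.mem_image_of_mem _ hi, htE i hi⟩
  have hTle : T.card ≤ (separators E x y).card := Finset.card_image_le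
  by_cases hTc : T.card + 2 ≤ k
  · exact absurd (h.le_card_separators_of_hit hW hx hy hxy hTW hxT hyT hTc hit) (by omega)
  have hinj : Set.InjOn t (separators E x y) :=
    Finset.card_image_iff.1 (le_antisymm hTle (by rw [← hT]; omega))
  -- Here `T` has exactly `k - 1` points, one per separator. The separator found contains all of
  -- `T`, so its own representative is superfluous; `k ≥ 3` leaves another point of `T` to hit it.
  obtain ⟨i, hi, hiE⟩ := h.exists_eq_insert hx hy hxy hTW hxT hyT (by omega) hit
  have hti : t i ∈ T := Finset.mem_image_of_mem _ hi
  have hcard := Finset.card_erase_add_one hti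
  refine absurd (h.le_card_separators_of_hit (T := T.erase (t i)) hW hx hy hxy
    ((Finset.erase_subset _ _).trans hTW) (fun hm => hxT (Finset.mem_of_mem_erase hm))
    (fun hm => hyT (Finset.mem_of_mem_erase hm)) (by omega) fun j hj => ?_) (by omega)
  by_cases hij : j = i
  · subst hij
    obtain ⟨s, hs⟩ : (T.erase (t j)).Nonempty := Finset.card_pos.1 (by omega)
    refine ⟨s, hs, ?_⟩
    have := Finset.mem_of_mem_erase hs
    rcases hiE with e | e <;> rw [e] <;> exact Finset.mem_insert_of_mem this
  · exact ⟨t j, Finset.mem_erase.2 ⟨fun e => hij (hinj hj hi e), Finset.mem_image_of_mem _ hj⟩,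
      htE j hj⟩

end Distinguishing

/-! ### Degree counting in separating families -/

section Counting

theorem sum_inv_le_of_pairwise_add {α : Type*} [DecidableEq α] {k : ℕ} (hk : 3 ≤ k) {Q : Finset α}
    (hQ : Q.card ≤ k) {d : α → ℝ} (h2 : ∀ x ∈ Q, 2 ≤ d x)
    (hadd : ∀ x ∈ Q, ∀ y ∈ Q, x ≠ y → (k : ℝ) + 2 ≤ d x + d y) :
    ∑ x ∈ Q, (d x)⁻¹ ≤ 2 * k / (k + 2) := by
  have hk' : (3 : ℝ) ≤ k := by exact_mod_cast hk
  by_cases hall : ∀ x ∈ Q, ((k : ℝ) + 2) / 2 ≤ d x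
  · calc ∑ x ∈ Q, (d x)⁻¹ ≤ ∑ x ∈ Q, (((k : ℝ) + 2) / 2)⁻¹ :=
          Finset.sum_le_sum fun x hx => inv_anti₀ (by positivity) (hall x hx)
      _ = Q.card * (2 / (k + 2)) := by rw [Finset.sum_const, nsmul_eq_mul, inv_div]
      _ ≤ k * (2 / (k + 2)) := by gcongr
      _ = 2 * k / (k + 2) := by ring
  · push Not at hall
    obtain ⟨z, hz, hzd⟩ := hall
    have hz2 := h2 z hz
    have hpos : 0 < (k : ℝ) + 2 - d z := by linarith
    have hcard : ((Q.erase z).card : ℝ) ≤ k - 1 := by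
      have := Finset.card_erase_add_one hz
      have : (Q.erase z).card + 1 ≤ k := by omega
      have : ((Q.erase z).card : ℝ) + 1 ≤ k := by exact_mod_cast this
      linarith
    rw [← Finset.add_sum_erase Q _ hz]
    calc (d z)⁻¹ + ∑ x ∈ Q.erase z, (d x)⁻¹
        ≤ (d z)⁻¹ + ∑ x ∈ Q.erase z, ((k : ℝ) + 2 - d z)⁻¹ := by
          gcongr with x hx
          have := hadd x (Finset.mem_of_mem_erase hx) z hz (Finset.ne_of_mem_erase hx)
          linarith
      _ = (d z)⁻¹ + (Q.erase z).card * ((k : ℝ) + 2 - d z)⁻¹ := by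
          rw [Finset.sum_const, nsmul_eq_mul]
      _ ≤ (d z)⁻¹ + (k - 1) * ((k : ℝ) + 2 - d z)⁻¹ := by gcongr
      _ ≤ 2 * k / (k + 2) := by
          have h0 : 0 < d z := by linarith
          rw [le_div_iff₀ (by positivity), ← mul_le_mul_iff_left₀ (mul_pos h0 hpos)]
          have : ((d z)⁻¹ + (k - 1) * ((k : ℝ) + 2 - d z)⁻¹) * (k + 2) * (d z * (k + 2 - d z)) =
              ((k + 2 - d z) + (k - 1) * d z) * (k + 2) := by
            field_simp
          rw [this]
          -- The bound `1/t + (k-1)/(k+2-t)` is convex in `t` on `[2, (k+2)/2]`. At the right end it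
          -- equals `2k/(k+2)`; at `t = 2` the claim reduces to `(k-2)² ≥ 0`.
          nlinarith [mul_nonneg (sub_nonneg.2 hz2) (by linarith : 0 ≤ (k : ℝ) + 2 - 2 * d z),
            mul_nonneg (mul_nonneg (sub_nonneg.2 hz2) (by linarith : 0 ≤ (k : ℝ) + 2 - 2 * d z))
              (by linarith : (0 : ℝ) ≤ k), sq_nonneg ((k : ℝ) - 2)]

variable {α ι : Type*} [DecidableEq α] [Fintype ι] {k : ℕ}

/-- The number of sets of `E` that contain `x`. -/
def incidenceDegree (E : ι → Finset α) (x : α) : ℕ := (Finset.univ.filter fun i => x ∈ E i).card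

/-- The indices of the sets of `E` that meet `P`. -/
def meeting (E : ι → Finset α) (P : Finset α) : Finset ι :=
  Finset.univ.filter fun i => (E i ∩ P).Nonempty

variable {E : ι → Finset α} {P : Finset α}

theorem mem_meeting {i : ι} : i ∈ meeting E P ↔ (E i ∩ P).Nonempty := by simp [meeting]

theorem meeting_mono {P' : Finset α} (h : P' ⊆ P) : meeting E P' ⊆ meeting E P := fun i hi => by
  rw [mem_meeting] at hi ⊢
  exact hi.mono (Finset.inter_subset_inter_left h)

theorem card_separators_add (E : ι → Finset α) (x y : α) :
    (separators E x y).card + 2 * (Finset.univ.filter fun i => x ∈ E i ∧ y ∈ E i).card =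
      incidenceDegree E x + incidenceDegree E y := by
  simp only [separators, incidenceDegree, Finset.card_filter]
  rw [Finset.mul_sum, ← Finset.sum_add_distrib, ← Finset.sum_add_distrib]
  refine Finset.sum_congr rfl fun i _ => ?_
  by_cases hx : x ∈ E i <;> by_cases hy : y ∈ E i <;> simp [hx, hy]

theorem sum_incidenceDegree_mul {R : Type*} [CommSemiring R] (E : ι → Finset α) (P : Finset α)
    (f : α → R) :
    ∑ x ∈ P, (incidenceDegree E x : R) * f x = ∑ i ∈ meeting E P, ∑ x ∈ E i ∩ P, f x := by
  have h1 : ∑ i ∈ meeting E P, ∑ x ∈ E i ∩ P, f x = ∑ i, ∑ x ∈ E i ∩ P, f x := by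
    refine Finset.sum_subset (Finset.subset_univ _) fun i _ hi => ?_
    rw [mem_meeting, Finset.not_nonempty_iff_eq_empty] at hi
    rw [hi, Finset.sum_empty]
  have h2 : ∀ i, ∑ x ∈ E i ∩ P, f x = ∑ x ∈ P, if x ∈ E i then f x else 0 := fun i => by
    rw [← Finset.sum_filter, Finset.inter_comm, Finset.filter_mem_eq_inter]
  rw [h1]
  simp only [h2]
  rw [Finset.sum_comm]
  refine Finset.sum_congr rfl fun x _ => ?_
  rw [← Finset.sum_filter, Finset.sum_const, nsmul_eq_mul, incidenceDegree]

/-- Any two points of `P` are separated by at least `k` sets of `E`, which have at most `k` points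
in `P`. -/
structure IsSeparatingFamily (E : ι → Finset α) (P : Finset α) (k : ℕ) : Prop where
  card_le : ∀ i, (E i ∩ P).card ≤ k
  le_card : ∀ x ∈ P, ∀ y ∈ P, x ≠ y → k ≤ (separators E x y).card

namespace IsSeparatingFamily

theorem mono (h : IsSeparatingFamily E P k) {P' : Finset α} (hP : P' ⊆ P) :
    IsSeparatingFamily E P' k where
  card_le i := (Finset.card_le_card (Finset.inter_subset_inter_left hP)).trans (h.card_le i)
  le_card x hx y hy := h.le_card x (hP hx) y (hP hy)

theorem le_add (h : IsSeparatingFamily E P k) {x y : α} (hx : x ∈ P) (hy : y ∈ P) (hxy : x ≠ y) :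
    k ≤ incidenceDegree E x + incidenceDegree E y := by
  have := h.le_card x hx y hy hxy
  have := card_separators_add E x y
  omega

theorem add_two_le_add (h : IsSeparatingFamily E P k) {x y : α} (hx : x ∈ P) (hy : y ∈ P)
    (hxy : x ≠ y) {i : ι} (hxi : x ∈ E i) (hyi : y ∈ E i) :
    k + 2 ≤ incidenceDegree E x + incidenceDegree E y := by
  have := h.le_card x hx y hy hxy
  have := card_separators_add E x y
  have : 0 < (Finset.univ.filter fun i => x ∈ E i ∧ y ∈ E i).card :=
    Finset.card_pos.2 ⟨i, by simp [hxi, hyi]⟩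
  omega

theorem card_mul_le_of_two_le (h : IsSeparatingFamily E P k) (hk : 3 ≤ k)
    (h2 : ∀ x ∈ P, 2 ≤ incidenceDegree E x) : P.card * (k + 2) ≤ 2 * k * (meeting E P).card := by
  have key : (P.card : ℝ) ≤ (meeting E P).card * (2 * k / (k + 2)) := by
    calc (P.card : ℝ) = ∑ x ∈ P, (incidenceDegree E x : ℝ) * (incidenceDegree E x : ℝ)⁻¹ := by
          rw [Finset.cast_card]
          refine Finset.sum_congr rfl fun x hx => (mul_inv_cancel₀ ?_).symm
          have := h2 x hx
          exact_mod_cast (by omega : incidenceDegree E x ≠ 0)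
      _ = ∑ i ∈ meeting E P, ∑ x ∈ E i ∩ P, (incidenceDegree E x : ℝ)⁻¹ :=
          sum_incidenceDegree_mul E P _
      _ ≤ ∑ i ∈ meeting E P, (2 * k / (k + 2) : ℝ) := by
          refine Finset.sum_le_sum fun i _ => sum_inv_le_of_pairwise_add hk (h.card_le i) ?_ ?_
          · intro x hx
            exact_mod_cast h2 x (Finset.mem_inter.1 hx).2
          · intro x hx y hy hxy
            rw [Finset.mem_inter] at hx hy
            exact_mod_cast h.add_two_le_add hx.2 hy.2 hxy hx.1 hy.1
      _ = _ := by rw [Finset.sum_const, nsmul_eq_mul]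
  rw [mul_div_assoc', le_div_iff₀ (by positivity)] at key
  have : (P.card * (k + 2) : ℝ) ≤ 2 * k * (meeting E P).card := by linarith
  exact_mod_cast this

/-- Since degrees of two points add up to at least `k ≥ 3`, at most one point has degree below two;
discarding it costs `k + 2`. -/
theorem card_mul_le_add (h : IsSeparatingFamily E P k) (hk : 3 ≤ k) :
    P.card * (k + 2) ≤ 2 * k * (meeting E P).card + (k + 2) := by
  by_cases h2 : ∀ x ∈ P, 2 ≤ incidenceDegree E x
  · exact (h.card_mul_le_of_two_le hk h2).trans (Nat.le_add_right _ _)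
  · push Not at h2
    obtain ⟨z, hz, hz2⟩ := h2
    have h1 := (h.mono (Finset.erase_subset z P)).card_mul_le_of_two_le hk fun x hx => by
      have := h.le_add (Finset.mem_of_mem_erase hx) hz (Finset.ne_of_mem_erase hx)
      omega
    have h2 := Finset.card_le_card (meeting_mono (E := E) (Finset.erase_subset z P))
    rw [← Finset.card_erase_add_one hz]
    have := Nat.mul_le_mul_left (2 * k) h2
    linarith

theorem sum_incidenceDegree_eq (E : ι → Finset α) (P : Finset α) :
    ∑ x ∈ P, incidenceDegree E x = ∑ i ∈ meeting E P, (E i ∩ P).card := by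
  simpa using sum_incidenceDegree_mul E P (fun _ => (1 : ℕ))

theorem sum_incidenceDegree_le (h : IsSeparatingFamily E P k) :
    ∑ x ∈ P, incidenceDegree E x ≤ k * (meeting E P).card := by
  rw [sum_incidenceDegree_eq, mul_comm, ← smul_eq_mul]
  exact Finset.sum_le_card_nsmul _ _ _ fun i _ => h.card_le i

theorem erase_mul_add_le (h : IsSeparatingFamily E P k) {z : α} (hz : z ∈ P) :
    (P.erase z).card * (k - incidenceDegree E z) + incidenceDegree E z ≤
      k * (meeting E P).card := by
  refine le_trans ?_ h.sum_incidenceDegree_le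
  rw [← Finset.sum_erase_add P _ hz, ← smul_eq_mul]
  gcongr
  refine Finset.card_nsmul_le_sum _ _ _ fun x hx => ?_
  have := h.le_add (Finset.mem_of_mem_erase hx) hz (Finset.ne_of_mem_erase hx)
  omega

/-- Points of degree two lie on pairwise disjoint pairs of edges, so they number at most half the
edges. All other points except `z` have degree at least three, and those sharing the edge of `z` at
least four, which compensates for `z`. -/
theorem six_mul_card_le (h : IsSeparatingFamily E P 3) {z : α} (hz : z ∈ P)
    (hdz : incidenceDegree E z = 1) : 6 * P.card ≤ 7 * (meeting E P).card := by
  classical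
  obtain ⟨e, he⟩ : (Finset.univ.filter fun i => z ∈ E i).Nonempty :=
    Finset.card_pos.1 (by rw [incidenceDegree] at hdz; omega)
  have hze : z ∈ E e := by simpa using he
  have heJ : e ∈ meeting E P := mem_meeting.2 ⟨z, Finset.mem_inter.2 ⟨hze, hz⟩⟩
  set L := P.filter fun x => incidenceDegree E x = 2 with hL
  have hLP : L ⊆ P := Finset.filter_subset _ _
  have hL2 : 2 * L.card ≤ (meeting E P).card := by
    have h1 : ∑ x ∈ L, incidenceDegree E x = 2 * L.card := by
      rw [Finset.sum_congr rfl fun x hx => (Finset.mem_filter.1 hx).2, Finset.sum_const,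
        smul_eq_mul, mul_comm]
    rw [← h1, sum_incidenceDegree_eq]
    calc _ ≤ (meeting E L).card • 1 := Finset.sum_le_card_nsmul _ _ _ fun i _ => by
            refine Finset.card_le_one.2 fun x hx y hy => ?_
            by_contra hxy
            simp only [hL, Finset.mem_inter, Finset.mem_filter] at hx hy
            have := h.add_two_le_add hx.2.1 hy.2.1 hxy hx.1 hy.1
            omega
      _ = (meeting E L).card := by simp
      _ ≤ _ := Finset.card_le_card (meeting_mono hLP)
  have hsum : ∑ x ∈ P, (3 + if x ∈ E e then 1 else 0) ≤
      ∑ x ∈ P, ((incidenceDegree E x + if incidenceDegree E x = 2 then 1 else 0) +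
        if x = z then 3 else 0) := by
    refine Finset.sum_le_sum fun x hx => ?_
    by_cases hxz : x = z
    · subst hxz
      simp [hze, hdz]
    · have h2 := h.le_add hx hz hxz
      by_cases hxe : x ∈ E e
      · have := h.add_two_le_add hx hz hxz hxe hze
        simp only [hxe, hxz, if_true, if_false]
        omega
      · simp only [hxe, hxz, if_false]
        split_ifs <;> omega
  have hcardE : ∑ x ∈ P, (if x ∈ E e then 1 else 0) = (E e ∩ P).card := by
    rw [← Finset.card_filter, Finset.inter_comm, Finset.filter_mem_eq_inter]
  have hcardL : ∑ x ∈ P, (if incidenceDegree E x = 2 then 1 else 0) = L.card := by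
    rw [← Finset.card_filter]
  rw [Finset.sum_add_distrib, Finset.sum_add_distrib, Finset.sum_add_distrib, hcardE, hcardL,
    Finset.sum_ite_eq' P z, if_pos hz, Finset.sum_const, smul_eq_mul, sum_incidenceDegree_eq,
    ← Finset.sum_erase_add _ _ heJ] at hsum
  have hrest : ∑ i ∈ (meeting E P).erase e, (E i ∩ P).card ≤ ((meeting E P).erase e).card * 3 := by
    rw [← smul_eq_mul]
    exact Finset.sum_le_card_nsmul _ _ _ fun i _ => h.card_le i
  have := Finset.card_erase_add_one heJ
  omega

/-- A point of degree 0 or 1 forces degree at least `k - 1` on all others, which for `k ≥ 5` already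
exceeds what is needed; degree 1 with `k = 3` is treated by `six_mul_card_le`. -/
theorem card_mul_le_of_odd (h : IsSeparatingFamily E P k) (hk : 3 ≤ k) (hodd : Odd k) {s : ℕ}
    (hs : 2 * k ≤ P.card + s) :
    P.card * (k + 2) ≤ 2 * k * (meeting E P).card + s * (k - 2) := by
  by_cases h2 : ∀ x ∈ P, 2 ≤ incidenceDegree E x
  · exact (h.card_mul_le_of_two_le hk h2).trans (Nat.le_add_right _ _)
  push Not at h2
  obtain ⟨z, hz, hz2⟩ := h2
  have h1 := h.erase_mul_add_le hz
  have hp := Finset.card_erase_add_one hz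
  have hz01 : incidenceDegree E z = 0 ∨ incidenceDegree E z = 1 := by omega
  obtain ⟨c, rfl⟩ : ∃ c, k = c + 3 := ⟨k - 3, by omega⟩
  rcases hz01 with hz0 | hz1
  · rw [hz0] at h1
    simp only [Nat.sub_zero, show c + 3 - 2 = c + 1 by omega] at *
    rw [← hp] at hs ⊢
    nlinarith [Nat.mul_le_mul_right c hs]
  · rcases Nat.eq_zero_or_pos c with rfl | hc
    · have := h.six_mul_card_le hz hz1
      simp only [Nat.zero_add] at *
      nlinarith [Nat.zero_le (s * (3 - 2))]
    · have hc2 : 2 ≤ c := by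
        rcases hodd with ⟨b, hb⟩
        omega
      obtain ⟨b, rfl⟩ : ∃ b, c = b + 2 := ⟨c - 2, by omega⟩
      rw [hz1] at h1
      simp only [show b + 2 + 3 - 2 = b + 3 by omega, show b + 2 + 3 - 1 = b + 4 by omega] at *
      rw [← hp] at hs ⊢
      nlinarith [Nat.mul_le_mul_right b hs]

end IsSeparatingFamily

end Counting

/-! ### From probes to separating families -/

section KneserLower

variable {α ι : Type*} [DecidableEq α] [Fintype ι] {k : ℕ}

/-- The points `x` of `W` such that some set of `E` meets `W` only in `x`. -/
def loners (E : ι → Finset α) (W : Finset α) : Finset α :=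
  W.filter fun x => ∃ i, E i ∩ W = {x}

/-- Each loner owns a probe that misses all other points of `W`, hence is not counted in `meeting`.
-/
theorem card_meeting_sdiff_loners_add (E : ι → Finset α) (W : Finset α) :
    (meeting E (W \ loners E W)).card + (loners E W).card ≤ Fintype.card ι := by
  classical
  have hex : ∀ x ∈ loners E W, ∃ i, E i ∩ W = {x} := fun x hx => (Finset.mem_filter.1 hx).2
  by_cases hne : (loners E W).Nonempty
  · obtain ⟨x₀, hx₀⟩ := hne
    have : Nonempty ι := (hex x₀ hx₀).nonempty
    choose! f hf using hex
    have hle : (loners E W).card ≤ (meeting E (W \ loners E W))ᶜ.card := by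
      refine Finset.card_le_card_of_injOn f (fun x hx => ?_) fun x hx y hy hxy => ?_
      · simp only [Finset.coe_compl, Set.mem_compl_iff, Finset.mem_coe, mem_meeting]
        rintro ⟨y, hy⟩
        simp only [Finset.mem_inter, Finset.mem_sdiff] at hy
        have : y ∈ E (f x) ∩ W := Finset.mem_inter.2 ⟨hy.1, hy.2.1⟩
        rw [hf x hx, Finset.mem_singleton] at this
        exact hy.2.2 (this ▸ hx)
      · exact Finset.singleton_injective ((hf x hx).symm.trans (hxy ▸ hf y hy))
    have := Finset.card_add_card_compl (meeting E (W \ loners E W))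
    omega
  · rw [Finset.not_nonempty_iff_eq_empty] at hne
    rw [hne, Finset.card_empty, add_zero]
    exact Finset.card_le_univ _

theorem DistinguishesSubsets.isSeparatingFamily {E : ι → Finset α} {W : Finset α}
    (h : DistinguishesSubsets E W k) (hk : 3 ≤ k) (hW : 2 * k ≤ W.card)
    (hE : ∀ i, (E i).card = k) : IsSeparatingFamily E (W \ loners E W) k where
  card_le i := (Finset.card_le_card Finset.inter_subset_left).trans (hE i).le
  le_card x hx y hy hxy := by
    have aux : ∀ z ∈ W \ loners E W, ∀ i, E i ∩ W ≠ {z} := fun z hz i hi =>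
      (Finset.mem_sdiff.1 hz).2 (Finset.mem_filter.2 ⟨(Finset.mem_sdiff.1 hz).1, i, hi⟩)
    exact h.le_card_separators hk hW (Finset.mem_sdiff.1 hx).1 (Finset.mem_sdiff.1 hy).1 hxy
      (aux x hx) (aux y hy)

theorem DistinguishesSubsets.card_mul_le_add {E : ι → Finset α} {W : Finset α}
    (h : DistinguishesSubsets E W k) (hk : 3 ≤ k) (hW : 2 * k ≤ W.card)
    (hE : ∀ i, (E i).card = k) : W.card * (k + 2) ≤ 2 * k * Fintype.card ι + (k + 2) := by
  have h1 := (h.isSeparatingFamily hk hW hE).card_mul_le_add hk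
  have h2 := card_meeting_sdiff_loners_add E W
  have h3 : (W \ loners E W).card + (loners E W).card = W.card :=
    Finset.card_sdiff_add_card_eq_card (Finset.filter_subset _ _)
  have h4 := Nat.mul_le_mul_left (2 * k) h2
  have h5 := Nat.mul_le_mul_left (loners E W).card (by omega : k + 2 ≤ 2 * k)
  rw [← h3]
  linarith

theorem DistinguishesSubsets.card_mul_le_of_odd {E : ι → Finset α} {W : Finset α}
    (h : DistinguishesSubsets E W k) (hk : 3 ≤ k) (hodd : Odd k) (hW : 2 * k ≤ W.card)
    (hE : ∀ i, (E i).card = k) : W.card * (k + 2) ≤ 2 * k * Fintype.card ι := by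
  have h3 : (W \ loners E W).card + (loners E W).card = W.card :=
    Finset.card_sdiff_add_card_eq_card (Finset.filter_subset _ _)
  -- The slack `s` is the number of loners: the probe of a loner contributes `2k = (k + 2) + (k -
  -- 2)`, which pays for its point and for the slack.
  have h1 := (h.isSeparatingFamily hk hW hE).card_mul_le_of_odd hk hodd (h3 ▸ hW)
  have h2 := Nat.mul_le_mul_left (2 * k) (card_meeting_sdiff_loners_add E W)
  have h5 : (loners E W).card * (k + 2) + (loners E W).card * (k - 2) =
      2 * k * (loners E W).card := by
    rw [← mul_add, show k + 2 + (k - 2) = 2 * k by omega, mul_comm]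
  rw [← h3]
  linarith

variable {n : ℕ}

theorem distinguishesSubsets_of_dist (hk : 1 ≤ k) (hn : 3 * k ≤ n) {W : Finset (Fin n)}
    (s : ι → {s : Finset (Fin n) // s.card = k})
    (h : ∀ u v : {s : Finset (Fin n) // s.card = k}, u.1 ⊆ W → v.1 ⊆ W →
      (∀ i, (kneserGraph k n).dist (s i) u = (kneserGraph k n).dist (s i) v) → u = v) :
    DistinguishesSubsets (fun i => (s i).1) W k := by
  intro u hu v hv huk hvk huv
  by_contra! hcon
  refine huv (congrArg Subtype.val (h ⟨u, huk⟩ ⟨v, hvk⟩ hu hv fun i => ?_))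
  obtain ⟨h1, h2, h3⟩ := hcon i
  exact kneserGraph_dist_eq_dist hk hn (fun e => h1 (congrArg Subtype.val e))
    (fun e => h2 (congrArg Subtype.val e)) h3

theorem exists_distinguishesSubsets_of_copsWin (hk : 1 ≤ k) (hn : 3 * k ≤ n) {m : ℕ}
    (h : (kneserGraph k n).CopsWin m) :
    ∃ (W : Finset (Fin n)) (E : Fin m → Finset (Fin n)), W.card = n - k ∧
      (∀ i, (E i).card = k) ∧ DistinguishesSubsets E W k := by
  have := kneserGraph_nonempty (k := k) (n := n) (by omega)
  obtain ⟨w, s, hs⟩ := h.exists_resolving_neighborhood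
  have hadj : ∀ u : {s : Finset (Fin n) // s.card = k}, u.1 ⊆ w.1ᶜ →
      (kneserGraph k n).Adj w u := fun u hu => by
    rw [kneserGraph_adj_iff hk]
    exact Finset.disjoint_left.2 fun x hx hxu => Finset.mem_compl.1 (hu hxu) hx
  refine ⟨w.1ᶜ, fun i => (s i).1, by rw [Finset.card_compl, Fintype.card_fin, w.2],
    fun i => (s i).2, distinguishesSubsets_of_dist hk hn s fun u v hu hv h => ?_⟩
  exact hs u v (Or.inr (hadj u hu)) (Or.inr (hadj v hv)) h

theorem distinguishesSubsets_of_isResolvingSet (hk : 1 ≤ k) (hn : 3 * k ≤ n)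
    {S : Finset {s : Finset (Fin n) // s.card = k}} (h : (kneserGraph k n).IsResolvingSet S) :
    DistinguishesSubsets (fun s : S => s.1.1) Finset.univ k :=
  distinguishesSubsets_of_dist hk hn (fun s : S => s.1) fun u v _ _ huv =>
    h u v fun s hs => huv ⟨s, hs⟩

end KneserLower

/-! ### Bounds for both numbers -/

section KneserBounds

variable {k n : ℕ}

theorem exists_isResolvingSet_eq_metricDimension (hk : 1 ≤ k) (hn : 3 * k ≤ n) :
    ∃ S, S.card = (kneserGraph k n).metricDimension ∧ (kneserGraph k n).IsResolvingSet S :=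
  SimpleGraph.exists_isResolvingSet_card_eq_metricDimension
    (SimpleGraph.isResolvingSet_univ _ (kneserGraph_connected hk hn))

theorem localizationNumber_le_metricDimension_kneserGraph (hk : 1 ≤ k) (hn : 3 * k ≤ n) :
    (kneserGraph k n).localizationNumber ≤ (kneserGraph k n).metricDimension :=
  (SimpleGraph.isResolvingSet_univ _
    (kneserGraph_connected hk hn)).localizationNumber_le_metricDimension

theorem copsWin_localizationNumber_kneserGraph (hk : 1 ≤ k) (hn : 3 * k ≤ n) :
    (kneserGraph k n).CopsWin (kneserGraph k n).localizationNumber :=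
  (SimpleGraph.isResolvingSet_univ _ (kneserGraph_connected hk hn)).copsWin_localizationNumber

theorem metricDimension_kneserGraph_le {d : ℕ} (hk : 1 ≤ k) (hd : k + 2 ≤ 2 * d) :
    ∃ C : ℕ, ∀ n, 3 * k ≤ n → k * (kneserGraph k n).metricDimension ≤ d * n + C := by
  obtain ⟨C, hC⟩ := exists_isResolvingSet_kneserGraph hk hd
  refine ⟨C, fun n hn => ?_⟩
  obtain ⟨S, hS, hcard⟩ := hC n hn
  exact (Nat.mul_le_mul_left k hS.metricDimension_le).trans hcard

theorem le_localizationNumber_kneserGraph (hk : 3 ≤ k) (hn : 3 * k ≤ n) :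
    (n - k) * (k + 2) ≤ 2 * k * (kneserGraph k n).localizationNumber + (k + 2) := by
  obtain ⟨W, E, hW, hE, h⟩ := exists_distinguishesSubsets_of_copsWin (by omega) hn
    (copsWin_localizationNumber_kneserGraph (by omega) hn)
  simpa [hW] using h.card_mul_le_add hk (by omega) hE

theorem le_localizationNumber_kneserGraph_of_odd (hk : 3 ≤ k) (hodd : Odd k) (hn : 3 * k ≤ n) :
    (n - k) * (k + 2) ≤ 2 * k * (kneserGraph k n).localizationNumber := by
  obtain ⟨W, E, hW, hE, h⟩ := exists_distinguishesSubsets_of_copsWin (by omega) hn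
    (copsWin_localizationNumber_kneserGraph (by omega) hn)
  simpa [hW] using h.card_mul_le_of_odd hk hodd (by omega) hE

theorem le_metricDimension_kneserGraph_of_odd (hk : 3 ≤ k) (hodd : Odd k) (hn : 3 * k ≤ n) :
    n * (k + 2) ≤ 2 * k * (kneserGraph k n).metricDimension := by
  obtain ⟨S, hS, hres⟩ := exists_isResolvingSet_eq_metricDimension (by omega) hn
  have h := distinguishesSubsets_of_isResolvingSet (by omega) hn hres
  simpa [hS] using h.card_mul_le_of_odd hk hodd (by simp; omega) (fun s => s.1.2)

end KneserBounds

theorem theorem2p7 :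
    (∀ k : ℕ, Even k → 4 ≤ k → ∃ C : ℝ, ∀ n : ℕ, 3 * k ≤ n →
      |((kneserGraph k n).localizationNumber : ℝ) - ((n : ℝ) / 2 + (n : ℝ) / k)| ≤ C ∧
      |((kneserGraph k n).metricDimension : ℝ) - ((n : ℝ) / 2 + (n : ℝ) / k)| ≤ C) ∧
    (∀ k : ℕ, Odd k → 3 ≤ k → ∃ C : ℝ, ∀ n : ℕ, 3 * k ≤ n →
      ((n : ℝ) / 2 + (n : ℝ) / k - (k : ℝ) / 2 - 1 ≤
          ((kneserGraph k n).localizationNumber : ℝ) ∧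
        ((kneserGraph k n).localizationNumber : ℝ) ≤
          (n : ℝ) / 2 + (n : ℝ) / k + (n : ℝ) / (2 * k) + C) ∧
      ((n : ℝ) / 2 + (n : ℝ) / k ≤ ((kneserGraph k n).metricDimension : ℝ) ∧
        ((kneserGraph k n).metricDimension : ℝ) ≤
          (n : ℝ) / 2 + (n : ℝ) / k + (n : ℝ) / (2 * k) + C)) := by
  constructor
  · rintro k ⟨j, hj⟩ hk
    -- For even `k` the choice `d = k/2 + 1` makes `2d = k + 2` exact, so the upper and lower main
    -- terms agree.
    obtain ⟨C, hC⟩ := metricDimension_kneserGraph_le (k := k) (d := j + 1) (by omega) (by omega)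
    have hk0 : (0 : ℝ) < k := by exact_mod_cast (by omega : 0 < k)
    have hkj : (k : ℝ) = j + j := by exact_mod_cast hj
    refine ⟨max (C / k) (k / 2 + 1 + (k + 2) / (2 * k)), fun n hn => ?_⟩
    have hup := hC n hn
    have hle := localizationNumber_le_metricDimension_kneserGraph (by omega) hn
    have hlow := le_localizationNumber_kneserGraph (by omega) hn
    generalize (kneserGraph k n).localizationNumber = z at *
    generalize (kneserGraph k n).metricDimension = b at *
    have hup' : (k : ℝ) * b ≤ (j + 1) * n + C := by exact_mod_cast hup
    have hle' : (z : ℝ) ≤ b := by exact_mod_cast hle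
    have hlow' : ((n : ℝ) - k) * (k + 2) ≤ 2 * k * z + (k + 2) := by
      rw [← Nat.cast_sub (by omega)]
      exact_mod_cast hlow
    have h1 : (b : ℝ) ≤ n / 2 + n / k + C / k := by
      have e : (n : ℝ) / 2 + n / k + C / k = ((j + 1) * n + C) / k := by
        rw [show (j : ℝ) = k / 2 by linarith]
        field_simp
      rw [e, le_div_iff₀ hk0]
      linarith
    have h2 : (n : ℝ) / 2 + n / k - (k / 2 + 1 + (k + 2) / (2 * k)) ≤ z := by
      have e : (n : ℝ) / 2 + n / k - (k / 2 + 1 + (k + 2) / (2 * k)) =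
          ((n - k) * (k + 2) - (k + 2)) / (2 * k) := by
        field_simp
        ring
      rw [e, div_le_iff₀ (by positivity)]
      linarith
    have h3 := le_max_left ((C : ℝ) / k) (k / 2 + 1 + (k + 2) / (2 * k))
    have h4 := le_max_right ((C : ℝ) / k) (k / 2 + 1 + (k + 2) / (2 * k))
    constructor <;> rw [abs_le] <;> constructor <;> linarith
  · rintro k hodd hk
    obtain ⟨j, hj⟩ := id hodd
    -- For odd `k` the least admissible `d` is `(k + 3)/2`; this rounding causes the extra `n/(2k)`.
    obtain ⟨C, hC⟩ := metricDimension_kneserGraph_le (k := k) (d := j + 2) (by omega) (by omega)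
    have hk0 : (0 : ℝ) < k := by exact_mod_cast (by omega : 0 < k)
    have hkj : (k : ℝ) = 2 * j + 1 := by exact_mod_cast hj
    refine ⟨C / k, fun n hn => ?_⟩
    have hup := hC n hn
    have hle := localizationNumber_le_metricDimension_kneserGraph (by omega) hn
    have hlow := le_localizationNumber_kneserGraph_of_odd hk hodd hn
    have hlowb := le_metricDimension_kneserGraph_of_odd hk hodd hn
    generalize (kneserGraph k n).localizationNumber = z at *
    generalize (kneserGraph k n).metricDimension = b at *
    have hup' : (k : ℝ) * b ≤ (j + 2) * n + C := by exact_mod_cast hup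
    have hle' : (z : ℝ) ≤ b := by exact_mod_cast hle
    have hlow' : ((n : ℝ) - k) * (k + 2) ≤ 2 * k * z := by
      rw [← Nat.cast_sub (by omega)]
      exact_mod_cast hlow
    have hlowb' : (n : ℝ) * (k + 2) ≤ 2 * k * b := by exact_mod_cast hlowb
    have h1 : (b : ℝ) ≤ n / 2 + n / k + n / (2 * k) + C / k := by
      have e : (n : ℝ) / 2 + n / k + n / (2 * k) + C / k = ((j + 2) * n + C) / k := by
        rw [show (j : ℝ) = (k - 1) / 2 by linarith]
        field_simp
        ring
      rw [e, le_div_iff₀ hk0]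
      linarith
    have h2 : (n : ℝ) / 2 + n / k - k / 2 - 1 ≤ z := by
      have e : (n : ℝ) / 2 + n / k - k / 2 - 1 = ((n - k) * (k + 2)) / (2 * k) := by
        field_simp
        ring
      rw [e, div_le_iff₀ (by positivity)]
      linarith
    have h3 : (n : ℝ) / 2 + n / k ≤ b := by
      have e : (n : ℝ) / 2 + n / k = (n * (k + 2)) / (2 * k) := by
        field_simp
      rw [e, div_le_iff₀ (by positivity)]
      linarith
    exact ⟨⟨h2, hle'.trans h1⟩, h3, h1⟩
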